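/- Let $p$ be a prime, let $q=p^l$ with $l\ge 1$, let $\mathbb F_q$ be a finite field with $q$ elements, let $n\ge 2$ and $k\ge 1$ be integers, and let $M_{n,q}=M_n(\mathbb F_q)$ be the ring of $n\times n$ matrices over $\mathbb F_q$. Put $$P:=\{A^k+B^k\mid A,B\in M_{n,q}\},\qquad d_m:=\gcd(k,q^m-1)\ (m\ge 1),\qquad d:=d_1.$$ Suppose that $p$ does not divide $k$ and that $$q\ \ge\ \max\Bigl\{\sqrt{(d-1)^6+6d},\ (d_2-1)^2+1,\ \bigl\lfloor (d_3-1)^{4/3}\bigr\rfloor+1\Bigr\}.$$ Then $P=M_{n,q}$; that is, every $n\times n$ matrix over $\mathbb F_q$ is a sum of two $k$-th powers of $n\times n$ matrices over $\mathbb F_q$. -/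

import Mathlib

/-- The set `P` of sums `A ^ k + B ^ k` of two `k`-th powers of `n × n` matrices over `F`. -/
def sumTwoPowers (k n : ℕ) (F : Type*) [Field F] : Set (Matrix (Fin n) (Fin n) F) :=
  {X | ∃ A B : Matrix (Fin n) (Fin n) F, X = A ^ k + B ^ k}

/-- `d_m = gcd(k, q ^ m - 1)`. The subtraction is the usual one whenever `q ≥ 1`. -/
def dGcd (k q m : ℕ) : ℕ := Nat.gcd k (q ^ m - 1)

/-! Scalar and nonscalar matrices are treated separately. A scalar `t` is a sum of two `k`-th powers
in the extensions of degree 2 and 3, by Jacobi sums, as `(d_m - 1)^4 < q^m` for `m = 2, 3`. Writing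
`n = 2a + 3b`, the regular representation of `K₂^a × K₃^b` carries this to `n × n` matrices. A
nonscalar matrix is similar to one with any prescribed diagonal of the same trace
(`Matrix.exists_similar_diag_eq`). If that diagonal is `a i ^ k + b i ^ k`, the matrix splits as
lower plus upper triangular with diagonals `a i ^ k` and `b i ^ k`. Since `p ∤ k`, Hensel lifting
modulo the characteristic polynomial gives each summand a `k`-th root, provided 0 is at most a
simple eigenvalue. Matching the trace asks for four `d`-th powers in `F` with prescribed sum,
neither pair vanishing (`exists_sum_four_pow`); a Fourier count gives them once `(d - 1)^3 ≤ q` and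
`2d < q`. -/

section CharacterSums

/-! ### Sums of two powers by Jacobi sums -/

open Finset

/-- The indicator weight attached to `χ`: it is `1` at zero, `d` on the kernel of `χ` and zero
elsewhere. For `χ` of order `d` it counts the `d`-th roots. -/
noncomputable def kernelWeight {F : Type*} [Field F] (χ : MulChar F ℂ) (d : ℕ) (u : F) : ℝ :=
  open Classical in if u = 0 then 1 else if χ u = 1 then (d : ℝ) else 0

/-- On the cyclic group `Fˣ` a character is determined by its value at a generator `g`, so `χ (g ^
j) = 1` forces `orderOf χ ∣ j`. -/
lemma exists_pow_eq_of_apply_eq_one {F : Type*} [Field F] [Fintype F] (χ : MulChar F ℂ) {u : F}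
    (hu : χ u = 1) : ∃ x, x ^ orderOf χ = u := by
  have hu0 : u ≠ 0 := by
    rintro rfl
    rw [MulChar.map_zero] at hu
    exact zero_ne_one hu
  obtain ⟨g, hg⟩ := IsCyclic.exists_generator (α := Fˣ)
  have key : ∀ m : ℕ, χ g ^ m = 1 → orderOf χ ∣ m := by
    intro m hm
    apply orderOf_dvd_of_pow_eq_one
    rw [MulChar.eq_iff hg, MulChar.pow_apply_coe, hm, MulChar.one_apply_coe]
  obtain ⟨j, hj⟩ := (mem_powers_iff_mem_zpowers.mpr (hg (Units.mk0 u hu0)))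
  have hj' : (g : F) ^ j = u := by
    have := congrArg Units.val hj
    simpa using this
  obtain ⟨c, rfl⟩ := key j (by rw [← map_pow, hj', hu])
  exact ⟨(g : F) ^ c, by rw [← pow_mul, mul_comm, hj']⟩

lemma exists_pow_eq_of_kernelWeight_ne_zero {F : Type*} [Field F] [Fintype F] (χ : MulChar F ℂ)
    {u : F} (hu : kernelWeight χ (orderOf χ) u ≠ 0) : ∃ x, x ^ orderOf χ = u := by
  unfold kernelWeight at hu
  split_ifs at hu with h0 h1
  · exact ⟨0, by rw [h0, zero_pow (MulChar.orderOf_pos χ).ne']⟩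
  · exact exists_pow_eq_of_apply_eq_one χ h1
  · exact absurd rfl hu

lemma kernelWeight_nonneg {F : Type*} [Field F] (χ : MulChar F ℂ) (d : ℕ) (u : F) :
    0 ≤ kernelWeight χ d u := by
  unfold kernelWeight
  split_ifs <;> positivity

lemma kernelWeight_le {F : Type*} [Field F] (χ : MulChar F ℂ) {d : ℕ} (hd : 1 ≤ d) (u : F) :
    kernelWeight χ d u ≤ d := by
  have : (1 : ℝ) ≤ d := by exact_mod_cast hd
  unfold kernelWeight
  split_ifs <;> linarith

lemma kernelWeight_zero {F : Type*} [Field F] (χ : MulChar F ℂ) (d : ℕ) :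
    kernelWeight χ d 0 = 1 := by
  simp [kernelWeight]

lemma kernelWeight_sq {F : Type*} [Field F] [DecidableEq F] (χ : MulChar F ℂ) (d : ℕ) (u : F) :
    kernelWeight χ d u ^ 2 = d * kernelWeight χ d u - if u = 0 then (d : ℝ) - 1 else 0 := by
  unfold kernelWeight
  split_ifs
  · simp
  · ring
  · ring

/-- Orthogonality of the powers of `χ`. The term `i = 0` is the constant 1 rather than `χ ^ 0`,
which vanishes at 0; this accounts for the weight 1 there. -/
lemma kernelWeight_eq_sum {F : Type*} [Field F] [Fintype F] (χ : MulChar F ℂ) (u : F) :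
    (kernelWeight χ (orderOf χ) u : ℂ) = 1 + ∑ i ∈ Ico 1 (orderOf χ), (χ ^ i) u := by
  have hd := MulChar.orderOf_pos χ
  have h1 : (1 : ℂ) + ∑ i ∈ Ico 1 (orderOf χ), (χ ^ i) u = ∑ i ∈ range (orderOf χ), χ u ^ i := by
    rw [range_eq_Ico, sum_eq_sum_Ico_succ_bot hd, pow_zero]
    congr 1
    refine sum_congr rfl fun i hi => ?_
    rw [MulChar.pow_apply' _ (by have := (mem_Ico.mp hi).1; omega)]
  rw [h1]
  unfold kernelWeight
  split_ifs with h0 h2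
  · subst h0
    rw [MulChar.map_zero, zero_geom_sum, if_neg hd.ne']
    simp
  · simp [h2]
  · have := geom_sum_eq h2 (orderOf χ)
    rw [this, ← MulChar.pow_apply' _ hd.ne', pow_orderOf_eq_one,
      MulChar.one_apply (isUnit_iff_ne_zero.mpr h0)]
    simp

lemma MulChar.pow_ne_one_of_mem_Ico {F : Type*} [Field F] (χ : MulChar F ℂ) {i : ℕ}
    (hi : i ∈ Ico 1 (orderOf χ)) : χ ^ i ≠ 1 := by
  rw [mem_Ico] at hi
  exact pow_ne_one_of_lt_orderOf (by omega) hi.2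

lemma sum_kernelWeight {F : Type*} [Field F] [Fintype F] (χ : MulChar F ℂ) :
    ∑ u, kernelWeight χ (orderOf χ) u = Fintype.card F := by
  have : (∑ u, (kernelWeight χ (orderOf χ) u : ℂ)) = Fintype.card F := by
    simp_rw [kernelWeight_eq_sum, sum_add_distrib]
    rw [sum_comm, sum_eq_zero (s := Ico 1 (orderOf χ)) fun i hi =>
      MulChar.sum_eq_zero_of_ne_one (MulChar.pow_ne_one_of_mem_Ico χ hi)]
    simp
  exact_mod_cast this

lemma norm_gaussSum_sq {F : Type*} [Field F] [Fintype F] {χ : MulChar F ℂ} (hχ : χ ≠ 1)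
    {ψ : AddChar F ℂ} (hψ : ψ.IsPrimitive) : ‖gaussSum χ ψ‖ ^ 2 = Fintype.card F := by
  have h := gaussSum_mul_gaussSum_eq_card hχ hψ
  rw [← star_gaussSum_eq] at h
  have h2 : ((‖gaussSum χ ψ‖ ^ 2 : ℝ) : ℂ) = Fintype.card F := by
    rw [← h]
    push_cast
    exact (RCLike.mul_conj _).symm
  exact_mod_cast h2

lemma norm_gaussSum {F : Type*} [Field F] [Fintype F] {χ : MulChar F ℂ} (hχ : χ ≠ 1)
    {ψ : AddChar F ℂ} (hψ : ψ.IsPrimitive) : ‖gaussSum χ ψ‖ = √(Fintype.card F) := by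
  rw [← norm_gaussSum_sq hχ hψ, Real.sqrt_sq (norm_nonneg _)]

lemma MulChar.norm_apply {F : Type*} [Field F] [Fintype F] (χ : MulChar F ℂ) {u : F}
    (hu : u ≠ 0) : ‖χ u‖ = 1 := by
  have h := (MulChar.apply_mem_rootsOfUnity_orderOf χ hu)
  obtain ⟨z, hz, hz'⟩ := h
  rw [← hz']
  have : NeZero (orderOf χ) := ⟨(MulChar.orderOf_pos χ).ne'⟩
  exact Complex.norm_eq_one_of_mem_rootsOfUnity hz

lemma norm_jacobiSum_le {F : Type*} [Field F] [Fintype F] {χ φ : MulChar F ℂ} (hχ : χ ≠ 1)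
    (hφ : φ ≠ 1) : ‖jacobiSum χ φ‖ ≤ √(Fintype.card F) := by
  by_cases h : χ * φ = 1
  · obtain rfl : φ = χ⁻¹ := (inv_eq_of_mul_eq_one_right h).symm
    rw [jacobiSum_nontrivial_inv hχ, norm_neg, MulChar.norm_apply _ (by simp)]
    rw [Real.one_le_sqrt]
    exact_mod_cast Fintype.card_pos
  · have hp := AddChar.FiniteField.primitiveChar_to_Complex_isPrimitive F
    have := congrArg norm (jacobiSum_mul_nontrivial h (AddChar.FiniteField.primitiveChar_to_Complex F))
    rw [norm_mul, norm_mul, norm_gaussSum h hp, norm_gaussSum hχ hp, norm_gaussSum hφ hp] at this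
    have hpos : 0 < √(Fintype.card F : ℝ) := by
      rw [Real.sqrt_pos]
      exact_mod_cast Fintype.card_pos
    exact (mul_left_cancel₀ hpos.ne' this).le

lemma norm_sum_mul_apply_sub_le {F : Type*} [Field F] [Fintype F] {χ φ : MulChar F ℂ} (hχ : χ ≠ 1)
    (hφ : φ ≠ 1) {t : F} (ht : t ≠ 0) :
    ‖∑ u, χ u * φ (t - u)‖ ≤ √(Fintype.card F) := by
  have : ∑ u, χ u * φ (t - u) = χ t * φ t * jacobiSum χ φ := by
    rw [jacobiSum, mul_sum, ← Equiv.sum_comp (Equiv.mulLeft₀ t ht)]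
    refine sum_congr rfl fun u _ => ?_
    rw [Equiv.mulLeft₀_apply, ← mul_one_sub, map_mul, map_mul]
    ring
  rw [this, norm_mul, norm_mul, MulChar.norm_apply _ ht, MulChar.norm_apply _ ht]
  simpa using norm_jacobiSum_le hχ hφ

/-- Every element of a finite field with more than `(d - 1) ^ 4` elements is a sum of two
`d`-th powers, where `d` divides the order of the unit group. -/
theorem exists_pow_add_pow_eq {F : Type*} [Field F] [Fintype F] {d : ℕ}
    (hd : d ∣ Fintype.card F - 1) (hF : (d - 1) ^ 4 < Fintype.card F) (t : F) :
    ∃ x y : F, x ^ d + y ^ d = t := by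
  have hq : 1 < Fintype.card F := Fintype.one_lt_card
  have hd0 : d ≠ 0 := by
    rintro rfl
    rw [zero_dvd_iff] at hd
    omega
  rcases eq_or_ne t 0 with rfl | ht
  · exact ⟨0, 0, by simp [hd0]⟩
  obtain ⟨χ, rfl⟩ := MulChar.exists_mulChar_orderOf F hd (Complex.isPrimitiveRoot_exp d hd0)
  set d := orderOf χ
  set q := Fintype.card F
  -- The weighted number of representations of `t`: the product of constants gives `q`, the terms
  -- with a single character cancel, and `(d - 1)^2` Jacobi-type sums remain, each at most `√q`.
  have hsum : (∑ u, (kernelWeight χ d u : ℂ) * kernelWeight χ d (t - u)) =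
      q + ∑ i ∈ Ico 1 d, ∑ j ∈ Ico 1 d, ∑ u, (χ ^ i) u * (χ ^ j) (t - u) := by
    have hz : ∀ i ∈ Ico 1 d, ∑ u, (χ ^ i) u = 0 := fun i hi =>
      MulChar.sum_eq_zero_of_ne_one (MulChar.pow_ne_one_of_mem_Ico χ hi)
    have h1 : ∑ u, ∑ i ∈ Ico 1 d, (χ ^ i) u = 0 := by
      rw [sum_comm]
      exact sum_eq_zero hz
    have h2 : ∑ u, ∑ i ∈ Ico 1 d, (χ ^ i) (t - u) = 0 := by
      rw [← h1]
      exact Equiv.sum_comp (Equiv.subLeft t) fun u => ∑ i ∈ Ico 1 d, (χ ^ i) u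
    have h3 : ∑ u, (∑ i ∈ Ico 1 d, (χ ^ i) u) * ∑ j ∈ Ico 1 d, (χ ^ j) (t - u) =
        ∑ i ∈ Ico 1 d, ∑ j ∈ Ico 1 d, ∑ u, (χ ^ i) u * (χ ^ j) (t - u) := by
      simp_rw [sum_mul_sum]
      rw [sum_comm]
      exact sum_congr rfl fun i _ => sum_comm
    have hw : ∀ u, (kernelWeight χ d u : ℂ) = 1 + ∑ i ∈ Ico 1 d, (χ ^ i) u :=
      kernelWeight_eq_sum χ
    simp_rw [hw, add_mul, mul_add, one_mul, mul_one, sum_add_distrib]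
    rw [h3, h1, h2]
    simp [q]
  have hbound : ‖∑ i ∈ Ico 1 d, ∑ j ∈ Ico 1 d, ∑ u, (χ ^ i) u * (χ ^ j) (t - u)‖ ≤
      ((d - 1 : ℕ) : ℝ) * (((d - 1 : ℕ) : ℝ) * √q) := by
    calc _ ≤ ∑ i ∈ Ico 1 d, ∑ j ∈ Ico 1 d, √(q : ℝ) := by
          refine (norm_sum_le _ _).trans (sum_le_sum fun i hi => ?_)
          refine (norm_sum_le _ _).trans (sum_le_sum fun j hj => ?_)
          exact norm_sum_mul_apply_sub_le (MulChar.pow_ne_one_of_mem_Ico χ hi)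
            (MulChar.pow_ne_one_of_mem_Ico χ hj) ht
      _ = _ := by simp
  have hlt : ((d - 1 : ℕ) : ℝ) * (((d - 1 : ℕ) : ℝ) * √q) < q := by
    have h4 : ((d - 1 : ℕ) : ℝ) ^ 4 < q := by exact_mod_cast hF
    have h5 : ((d - 1 : ℕ) : ℝ) ^ 2 < √q := Real.lt_sqrt_of_sq_lt (by rw [← pow_mul]; exact h4)
    have h6 : √(q : ℝ) * √q = q := Real.mul_self_sqrt (by positivity)
    have h7 : 0 < √(q : ℝ) := lt_of_le_of_lt (by positivity) h5
    nlinarith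
  have hne : (∑ u, (kernelWeight χ d u : ℂ) * kernelWeight χ d (t - u)) ≠ 0 := by
    intro h0
    rw [hsum] at h0
    have := congrArg norm (eq_neg_of_add_eq_zero_left h0)
    rw [norm_neg, Complex.norm_natCast] at this
    linarith
  obtain ⟨u, -, hu⟩ := exists_ne_zero_of_sum_ne_zero hne
  rw [← Complex.ofReal_mul, Complex.ofReal_ne_zero] at hu
  obtain ⟨x, hx⟩ := exists_pow_eq_of_kernelWeight_ne_zero χ (left_ne_zero_of_mul hu)
  obtain ⟨y, hy⟩ := exists_pow_eq_of_kernelWeight_ne_zero χ (right_ne_zero_of_mul hu)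
  exact ⟨x, y, by rw [hx, hy]; ring⟩

end CharacterSums

/-! ### Sums of four powers by Fourier analysis -/

section FourPowers

open Finset

/-- The transform of a real-valued function on `F` along the twists of an additive character. -/
noncomputable def charTransform {F : Type*} [Field F] [Fintype F] (ψ : AddChar F ℂ) (f : F → ℝ)
    (a : F) : ℂ :=
  ∑ u, (f u : ℂ) * ψ (a * u)

/-- Additive convolution of real-valued functions on a finite field. -/
def addConv {F : Type*} [Field F] [Fintype F] (f g : F → ℝ) (v : F) : ℝ :=
  ∑ u, f u * g (v - u)

lemma charTransform_addConv {F : Type*} [Field F] [Fintype F] (ψ : AddChar F ℂ) (f g : F → ℝ)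
    (a : F) :
    charTransform ψ (addConv f g) a = charTransform ψ f a * charTransform ψ g a := by
  simp only [charTransform, addConv, Complex.ofReal_sum, Complex.ofReal_mul]
  simp_rw [sum_mul_sum, sum_mul]
  rw [sum_comm]
  refine sum_congr rfl fun u _ => ?_
  rw [← Equiv.sum_comp (Equiv.addRight u)]
  refine sum_congr rfl fun v _ => ?_
  rw [Equiv.coe_addRight, add_sub_cancel_right, mul_add, AddChar.map_add_eq_mul]
  ring

/-- Fourier inversion. -/
lemma sum_charTransform_mul {F : Type*} [Field F] [Fintype F] {ψ : AddChar F ℂ}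
    (hψ : ψ.IsPrimitive) (f : F → ℝ) (t : F) :
    ∑ a, charTransform ψ f a * ψ (-(a * t)) = Fintype.card F * f t := by
  classical
  simp only [charTransform, sum_mul]
  rw [sum_comm]
  have : ∀ u, ∑ a, (f u : ℂ) * ψ (a * u) * ψ (-(a * t)) =
      if u = t then (Fintype.card F : ℂ) * f t else 0 := by
    intro u
    have h := AddChar.sum_mulShift (u - t) hψ
    simp_rw [mul_assoc, ← AddChar.map_add_eq_mul, ← sub_eq_add_neg, ← mul_sub]
    rw [← mul_sum, h]
    simp only [sub_eq_zero]
    split_ifs with hut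
    · rw [hut, mul_comm]
    · simp
  simp_rw [this]
  simp

lemma charTransform_zero {F : Type*} [Field F] [Fintype F] (ψ : AddChar F ℂ) (f : F → ℝ) :
    charTransform ψ f 0 = ((∑ u, f u : ℝ) : ℂ) := by
  simp [charTransform]

/-- Parseval, as inversion at 0 for the convolution of `f` with its reflection. -/
lemma sum_norm_charTransform_sq {F : Type*} [Field F] [Fintype F] {ψ : AddChar F ℂ}
    (hψ : ψ.IsPrimitive) (f : F → ℝ) :
    ∑ a, ‖charTransform ψ f a‖ ^ 2 = Fintype.card F * ∑ u, f u ^ 2 := by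
  have h := sum_charTransform_mul hψ (addConv f fun u => f (-u)) 0
  have hc : ∀ a, charTransform ψ (fun u => f (-u)) a =
      (starRingEnd ℂ) (charTransform ψ f a) := by
    intro a
    simp only [charTransform, map_sum, map_mul, Complex.conj_ofReal]
    rw [← Equiv.sum_comp (Equiv.neg F)]
    refine sum_congr rfl fun u _ => ?_
    rw [Equiv.neg_apply, neg_neg, mul_neg, AddChar.map_neg_eq_conj]
  simp_rw [charTransform_addConv, hc, mul_zero, neg_zero, AddChar.map_zero_eq_one, mul_one] at h
  have h2 : ((∑ a, ‖charTransform ψ f a‖ ^ 2 : ℝ) : ℂ) =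
      ((Fintype.card F * ∑ u, f u ^ 2 : ℝ) : ℂ) := by
    push_cast
    calc _ = ∑ a, charTransform ψ f a * (starRingEnd ℂ) (charTransform ψ f a) :=
          sum_congr rfl fun a _ => (RCLike.mul_conj _).symm
      _ = _ := h
      _ = _ := by simp [addConv, sq]
  exact_mod_cast h2

/-- Away from 0 the constant part of the weight has zero transform; what remains is `d - 1` Gauss
sums of modulus `√q`. -/
lemma norm_charTransform_kernelWeight_le {F : Type*} [Field F] [Fintype F] {ψ : AddChar F ℂ}
    (hψ : ψ.IsPrimitive) (χ : MulChar F ℂ) {a : F} (ha : a ≠ 0) :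
    ‖charTransform ψ (kernelWeight χ (orderOf χ)) a‖ ≤
      ((orderOf χ - 1 : ℕ) : ℝ) * √(Fintype.card F) := by
  classical
  have hprim : (ψ.mulShift a).IsPrimitive := by
    intro b hb
    rw [AddChar.mulShift_mulShift]
    exact hψ (mul_ne_zero ha hb)
  have h : charTransform ψ (kernelWeight χ (orderOf χ)) a =
      ∑ i ∈ Ico 1 (orderOf χ), gaussSum (χ ^ i) (ψ.mulShift a) := by
    have h0 := AddChar.sum_mulShift a hψ
    rw [if_neg ha, Nat.cast_zero] at h0
    simp only [charTransform, kernelWeight_eq_sum, add_mul, one_mul, sum_add_distrib, sum_mul]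
    simp_rw [mul_comm a]
    rw [h0, zero_add, sum_comm]
    simp only [gaussSum, AddChar.mulShift_apply, mul_comm a]
  rw [h]
  calc _ ≤ ∑ i ∈ Ico 1 (orderOf χ), √(Fintype.card F : ℝ) := by
        refine (norm_sum_le _ _).trans (sum_le_sum fun i hi => ?_)
        exact (norm_gaussSum (MulChar.pow_ne_one_of_mem_Ico χ hi) hprim).le
    _ = _ := by simp

/-- With `e = d - 1` and `N` the weighted count, inversion gives `qN = q^4` plus an error. Of the
four transforms in the error, two are bounded pointwise by `e^2 q` and two summed by Parseval to `e
q (q - 1)`. The error is thus at most `e^3 q^2 (q - 1) ≤ q^4 - q^3`. Pointwise bounds alone would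
cost a fourth power of `e`. -/
lemma card_sq_le_addConv_kernelWeight {F : Type*} [Field F] [Fintype F] (χ : MulChar F ℂ)
    (hF : (orderOf χ - 1) ^ 3 ≤ Fintype.card F) (t : F) :
    (Fintype.card F : ℝ) ^ 2 ≤
      addConv (addConv (kernelWeight χ (orderOf χ)) (kernelWeight χ (orderOf χ)))
        (addConv (kernelWeight χ (orderOf χ)) (kernelWeight χ (orderOf χ))) t := by
  classical
  have hψ := AddChar.FiniteField.primitiveChar_to_Complex_isPrimitive F
  set ψ := AddChar.FiniteField.primitiveChar_to_Complex F
  set w := kernelWeight χ (orderOf χ) with hw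
  have hd : 1 ≤ orderOf χ := MulChar.orderOf_pos χ
  obtain ⟨e, he⟩ : ∃ e : ℕ, orderOf χ = e + 1 := ⟨orderOf χ - 1, by omega⟩
  set N := addConv (addConv w w) (addConv w w) t with hN
  set q : ℝ := (Fintype.card F : ℝ) with hq
  have hq1 : 1 ≤ q := by
    rw [hq]
    exact_mod_cast (Fintype.card_pos (α := F))
  have hwsum : ∑ u, w u = q := sum_kernelWeight χ
  have hwsq : ∑ u, w u ^ 2 = (e + 1) * q - e := by
    simp_rw [hw, kernelWeight_sq, sum_sub_distrib, ← mul_sum]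
    rw [← hw, hwsum, he]
    simp
  have hT0 : charTransform ψ w 0 = (q : ℂ) := by
    rw [charTransform_zero, hwsum]
  have hpars := sum_norm_charTransform_sq hψ w
  rw [hwsq, ← add_sum_erase _ _ (mem_univ (0 : F)), hT0, Complex.norm_real, Real.norm_eq_abs,
    sq_abs] at hpars
  have hmain := sum_charTransform_mul hψ (addConv (addConv w w) (addConv w w)) t
  simp_rw [charTransform_addConv] at hmain
  rw [← add_sum_erase _ _ (mem_univ (0 : F)), hT0, zero_mul, neg_zero,
    AddChar.map_zero_eq_one] at hmain
  have herr : ‖∑ a ∈ univ.erase 0, charTransform ψ w a * charTransform ψ w a *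
      (charTransform ψ w a * charTransform ψ w a) * ψ (-(a * t))‖ ≤
      (e ^ 2 * q) * ∑ a ∈ univ.erase 0, ‖charTransform ψ w a‖ ^ 2 := by
    rw [mul_sum]
    refine (norm_sum_le _ _).trans (sum_le_sum fun a ha => ?_)
    have hb := norm_charTransform_kernelWeight_le hψ χ (ne_of_mem_erase ha)
    rw [he, Nat.add_sub_cancel, ← he] at hb
    have hb2 : ‖charTransform ψ w a‖ ^ 2 ≤ e ^ 2 * q := by
      calc _ ≤ ((e : ℝ) * √q) ^ 2 := by gcongr
        _ = _ := by rw [mul_pow, Real.sq_sqrt (by linarith)]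
    simp only [norm_mul, AddChar.norm_apply, mul_one]
    nlinarith [sq_nonneg ‖charTransform ψ w a‖]
  have herr2 : ∑ a ∈ univ.erase 0, ‖charTransform ψ w a‖ ^ 2 = q * (q - 1) * e := by
    linarith
  rw [herr2] at herr
  have hlow : q ^ 4 - q * N ≤ (e ^ 2 * q) * (q * (q - 1) * e) := by
    refine le_trans ?_ herr
    have hE := eq_sub_of_add_eq' hmain
    rw [hE]
    have hcast : (Fintype.card F : ℂ) * (N : ℂ) - (q : ℂ) * q * (q * q) * 1 =
        ((q * N - q ^ 4 : ℝ) : ℂ) := by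
      rw [hq]
      push_cast
      ring
    rw [hcast, Complex.norm_real, Real.norm_eq_abs, abs_sub_comm]
    exact le_abs_self _
  have he3 : (e : ℝ) ^ 3 ≤ q := by
    rw [he, Nat.add_sub_cancel] at hF
    rw [hq]
    exact_mod_cast hF
  have : q * q ^ 2 ≤ q * N := by
    nlinarith [mul_le_mul_of_nonneg_right he3 (by nlinarith : 0 ≤ q * q * (q - 1))]
  exact le_of_mul_le_mul_left this (by linarith)

/-- If `d` divides the order of the unit group and the field is large compared to `d`, every
element is a sum of four `d`-th powers of which neither the first two nor the last two both
vanish. -/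
theorem exists_sum_four_pow {F : Type*} [Field F] [Fintype F] {d : ℕ}
    (hd : d ∣ Fintype.card F - 1) (hF : (d - 1) ^ 3 ≤ Fintype.card F)
    (hF2 : 2 * d < Fintype.card F) (t : F) :
    ∃ x y z w : F, x ^ d + y ^ d + (z ^ d + w ^ d) = t ∧ (x ≠ 0 ∨ y ≠ 0) ∧ (z ≠ 0 ∨ w ≠ 0) := by
  classical
  have hd0 : d ≠ 0 := by
    rintro rfl
    rw [zero_dvd_iff] at hd
    have := Fintype.one_lt_card (α := F)
    omega
  obtain ⟨χ, rfl⟩ := MulChar.exists_mulChar_orderOf F hd (Complex.isPrimitiveRoot_exp d hd0)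
  have hN := card_sq_le_addConv_kernelWeight χ hF t
  set d := orderOf χ with hdef
  set w := kernelWeight χ d with hw
  have hrt : addConv w w t ≤ d * Fintype.card F := by
    rw [← sum_kernelWeight χ, mul_sum]
    refine sum_le_sum fun u _ => ?_
    rw [mul_comm]
    exact mul_le_mul_of_nonneg_right (kernelWeight_le χ (by omega) _) (kernelWeight_nonneg χ _ _)
  -- Subtracting the indicator of 0 removes the representation `0 = 0^d + 0^d`, of weight 1, from
  -- each pair. The remaining count is at least `q^2 - 2dq > 0`.
  have hgood : ∑ v, (addConv w w v - if v = 0 then 1 else 0) *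
      (addConv w w (t - v) - if t - v = 0 then 1 else 0) =
      addConv (addConv w w) (addConv w w) t - 2 * addConv w w t + if t = 0 then 1 else 0 := by
    simp_rw [sub_mul, mul_sub, sum_sub_distrib]
    simp only [ite_mul, mul_ite, mul_one, mul_zero, one_mul, zero_mul, sum_ite_eq', mem_univ,
      if_true, sub_eq_zero, sum_ite_eq, sub_zero]
    rw [show addConv (addConv w w) (addConv w w) t =
      ∑ v, addConv w w v * addConv w w (t - v) from rfl]
    ring
  have hpos : ∑ v, (addConv w w v - if v = 0 then 1 else 0) *
      (addConv w w (t - v) - if t - v = 0 then 1 else 0) ≠ 0 := by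
    rw [hgood]
    have h1 : (2 * d : ℝ) < Fintype.card F := by exact_mod_cast hF2
    have h2 : (0 : ℝ) ≤ if t = 0 then 1 else 0 := by split_ifs <;> norm_num
    have h3 : (0 : ℝ) < Fintype.card F := lt_of_le_of_lt (by positivity) h1
    nlinarith
  have hex : ∀ v, (addConv w w v - if v = 0 then 1 else 0) ≠ 0 →
      ∃ x y : F, x ^ d + y ^ d = v ∧ (x ≠ 0 ∨ y ≠ 0) := by
    intro v hv
    have hsub : (addConv w w v - if v = 0 then 1 else 0) =
        ∑ u, (w u * w (v - u) - if u = 0 then if v = 0 then 1 else 0 else 0) := by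
      rw [sum_sub_distrib, addConv]
      simp
    rw [hsub] at hv
    obtain ⟨u, -, hu⟩ := exists_ne_zero_of_sum_ne_zero hv
    by_cases h0 : u = 0 ∧ v = 0
    · exfalso
      apply hu
      rw [h0.1, h0.2]
      simp [hw, kernelWeight_zero]
    · have hu' : w u * w (v - u) ≠ 0 := by
        rcases not_and_or.mp h0 with h | h <;> simpa [h] using hu
      obtain ⟨x, hx⟩ := exists_pow_eq_of_kernelWeight_ne_zero χ (left_ne_zero_of_mul hu')
      obtain ⟨y, hy⟩ := exists_pow_eq_of_kernelWeight_ne_zero χ (right_ne_zero_of_mul hu')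
      refine ⟨x, y, by rw [hx, hy]; ring, ?_⟩
      by_contra! hxy
      rw [hxy.1, zero_pow hd0] at hx
      rw [hxy.2, zero_pow hd0, ← hx, sub_zero] at hy
      exact h0 ⟨hx.symm, hy.symm⟩
  obtain ⟨v, -, hv⟩ := exists_ne_zero_of_sum_ne_zero hpos
  obtain ⟨x, y, hxy, hxy0⟩ := hex v (left_ne_zero_of_mul hv)
  obtain ⟨z, z', hz, hz0⟩ := hex (t - v) (right_ne_zero_of_mul hv)
  exact ⟨x, y, z, z', by rw [hxy, hz]; ring, hxy0, hz0⟩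

end FourPowers

/-! ### Roots of matrices with split characteristic polynomial -/

section PowersOfMatrices

open Polynomial

/-- Hensel lifting along a split polynomial: `X` has a `k`-th root modulo `∏ (X - a i)` if every
`a i` is a `k`-th power and zero is at most a simple root. -/
theorem exists_prod_X_sub_C_dvd_pow_sub_X {F ι : Type*} [Field F] {k : ℕ} (hk : (k : F) ≠ 0)
    (a : ι → F) (s : Finset ι) (ha : ∀ i ∈ s, ∃ h, h ^ k = a i)
    (h0 : ∀ i ∈ s, ∀ j ∈ s, a i = 0 → a j = 0 → i = j) :
    ∃ g : F[X], ∏ i ∈ s, (X - C (a i)) ∣ g ^ k - X := by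
  classical
  induction s using Finset.induction_on with
  | empty => exact ⟨0, by simp⟩
  | insert i s his ih =>
    obtain ⟨g, w, hw⟩ := ih (fun j hj => ha j (Finset.mem_insert_of_mem hj))
      (fun j hj l hl => h0 j (Finset.mem_insert_of_mem hj) l (Finset.mem_insert_of_mem hl))
    rw [Finset.prod_insert his]
    set f := ∏ j ∈ s, (X - C (a j)) with hf
    have hgk : g ^ k = f * w + X := by rw [← hw]; ring
    by_cases hfa : f.eval (a i) = 0
    · have hai : a i ≠ 0 := by
        intro hai
        rw [hf, eval_prod, Finset.prod_eq_zero_iff] at hfa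
        obtain ⟨j, hj, hji⟩ := hfa
        have hja : a j = 0 := by
          simpa [sub_eq_zero, hai] using hji
        have := h0 i (Finset.mem_insert_self _ _) j (Finset.mem_insert_of_mem hj) hai hja
        exact his (this ▸ hj)
      have hga : g.eval (a i) ≠ 0 := by
        intro hga
        have := congrArg (eval (a i)) hgk
        rw [eval_pow, hga, eval_add, eval_mul, hfa, zero_mul, eval_X, zero_add, zero_pow] at this
        · exact hai this.symm
        · rintro rfl
          simp at hk
      -- Newton step at a repeated root: `c` makes `w + k g^(k-1) c` vanish at `a i`. The
      -- denominator is nonzero because `k ≠ 0` in `F` and `g (a i) ^ k = a i ≠ 0`.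
      set c := -w.eval (a i) / (k * g.eval (a i) ^ (k - 1)) with hc
      obtain ⟨z, hz⟩ := powAddExpansion g (C c * f) k
      refine ⟨g + C c * f, ?_⟩
      have hfac : (g + C c * f) ^ k - X =
          f * (w + (k : F[X]) * g ^ (k - 1) * C c + z * C c ^ 2 * f) := by
        rw [hz, hgk]
        ring
      rw [hfac, mul_comm]
      refine mul_dvd_mul_left _ ?_
      rw [dvd_iff_isRoot, IsRoot.def]
      simp only [eval_add, eval_mul, eval_pow, eval_C, eval_natCast, hfa, mul_zero, add_zero]
      rw [hc]
      field_simp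
      ring
    · obtain ⟨h, hh⟩ := ha i (Finset.mem_insert_self _ _)
      -- New root: `c` is chosen so that the corrected polynomial takes the value `h` at `a i`, as
      -- in the Chinese remainder theorem.
      set c := (h - g.eval (a i)) / f.eval (a i) with hc
      refine ⟨g + C c * f, ?_⟩
      refine IsCoprime.mul_dvd ?_ ?_ ?_
      · rw [(irreducible_X_sub_C (a i)).coprime_iff_not_dvd, dvd_iff_isRoot]
        exact hfa
      · rw [dvd_iff_isRoot, IsRoot.def]
        simp only [eval_sub, eval_pow, eval_add, eval_mul, eval_C, eval_X]
        rw [hc, div_mul_cancel₀ _ hfa, add_sub_cancel, hh, sub_self]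
      · have h1 : f ∣ (g + C c * f) ^ k - g ^ k :=
          dvd_trans (by rw [add_sub_cancel_left]; exact dvd_mul_left _ _)
            (sub_dvd_pow_sub_pow (g + C c * f) g k)
        have h2 : f ∣ g ^ k - X := ⟨w, hw⟩
        simpa using dvd_add h1 h2

/-- By Cayley–Hamilton, `g ^ k ≡ X` modulo the characteristic polynomial gives `g(M) ^ k = M`. -/
theorem Matrix.exists_pow_eq_of_charpoly_eq {F ι : Type*} [Field F] [Fintype ι] [DecidableEq ι]
    {k : ℕ} (hk : (k : F) ≠ 0) (M : Matrix ι ι F) (a : ι → F)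
    (hM : M.charpoly = ∏ i, (X - C (a i))) (ha : ∀ i, ∃ h, h ^ k = a i)
    (h0 : ∀ i j, a i = 0 → a j = 0 → i = j) : ∃ A : Matrix ι ι F, A ^ k = M := by
  obtain ⟨g, w, hw⟩ := exists_prod_X_sub_C_dvd_pow_sub_X hk a Finset.univ (fun i _ => ha i)
    (fun i _ j _ => h0 i j)
  refine ⟨aeval M g, ?_⟩
  have := congrArg (aeval M) hw
  rw [← hM, map_mul, Matrix.aeval_self_charpoly, zero_mul, map_sub, map_pow, aeval_X] at this
  exact sub_eq_zero.mp this

/-- A square matrix whose diagonal entries are sums of `k`-th powers `a i ^ k + b i ^ k`, with at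
most one `a i` and at most one `b i` equal to zero, is a sum of two `k`-th powers. -/
theorem Matrix.exists_pow_add_pow_eq_of_diag {F ι : Type*} [Field F] [Fintype ι] [LinearOrder ι]
    {k : ℕ} (hk : (k : F) ≠ 0) (M : Matrix ι ι F) (a b : ι → F)
    (hM : ∀ i, M i i = a i ^ k + b i ^ k) (ha : ∀ i j, a i = 0 → a j = 0 → i = j)
    (hb : ∀ i j, b i = 0 → b j = 0 → i = j) :
    ∃ A B : Matrix ι ι F, A ^ k + B ^ k = M := by
  have hk0 : k ≠ 0 := by
    rintro rfl
    simp at hk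
  let L : Matrix ι ι F := .of fun i j => if j < i then M i j else if i = j then a i ^ k else 0
  let U : Matrix ι ι F := .of fun i j => if i < j then M i j else if i = j then b i ^ k else 0
  have hL : L.charpoly = ∏ i, (X - C (a i ^ k)) := by
    rw [← Matrix.charpoly_transpose, Matrix.charpoly_of_isUpperTriangular]
    · simp [L]
    · intro i j hij
      simp only [id] at hij
      simp [L, hij.not_gt, hij.ne]
  have hU : U.charpoly = ∏ i, (X - C (b i ^ k)) := by
    rw [Matrix.charpoly_of_isUpperTriangular]
    · simp [U]
    · intro i j hij
      simp only [id] at hij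
      simp [U, hij.not_gt, hij.ne']
  obtain ⟨A, hA⟩ := Matrix.exists_pow_eq_of_charpoly_eq hk L _ hL (fun i => ⟨a i, rfl⟩)
    (fun i j hi hj => ha i j (eq_zero_of_pow_eq_zero hi) (eq_zero_of_pow_eq_zero hj))
  obtain ⟨B, hB⟩ := Matrix.exists_pow_eq_of_charpoly_eq hk U _ hU (fun i => ⟨b i, rfl⟩)
    (fun i j hi hj => hb i j (eq_zero_of_pow_eq_zero hi) (eq_zero_of_pow_eq_zero hj))
  refine ⟨A, B, ?_⟩
  rw [hA, hB]
  ext i j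
  rcases lt_trichotomy i j with h | rfl | h
  · simp [L, U, h, h.not_gt, h.ne]
  · simp [L, U, hM]
  · simp [L, U, h, h.not_gt, h.ne']

end PowersOfMatrices

/-! ### Prescribing the diagonal of a nonscalar matrix -/

section PrescribedDiagonal

open Module

/-- For a nonscalar endomorphism `f` there are a vector `v` and a functional `φ` with `φ v = 1`,
`φ (f v) = c`, and such that the compression of `f` to `ker φ` along `v` is again nonscalar unless
`ker φ` is a line. -/
lemma LinearMap.exists_functional_of_not_scalar {F V : Type*} [Field F] [AddCommGroup V]
    [Module F V] [FiniteDimensional F V] {n : ℕ} (hV : finrank F V = n + 2) (f : V →ₗ[F] V)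
    (hf : ∀ μ : F, f ≠ μ • 1) (c : F) :
    ∃ (v : V) (φ : V →ₗ[F] F), φ v = 1 ∧ φ (f v) = c ∧
      (n = 0 ∨ ∀ μ : F, ∃ u, φ u = 0 ∧ ∀ a : F, f u ≠ μ • u + a • v) := by
  obtain ⟨v, hv⟩ : ∃ v, LinearIndependent F ![v, f v] := by
    by_contra! h
    obtain ⟨μ, hμ⟩ := LinearMap.exists_eq_smul_id_of_forall_notLinearIndependent h
    exact hf μ hμ
  rw [LinearIndependent.pair_iff] at hv
  have hvw : v ∉ Submodule.span F {f v - c • v} := by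
    intro hmem
    obtain ⟨s, hs⟩ := Submodule.mem_span_singleton.mp hmem
    obtain ⟨h1, h2⟩ := hv (-1 - s * c) s (by
      rw [sub_smul, neg_smul, one_smul, mul_smul]
      nth_rewrite 1 [← hs]
      rw [smul_sub]
      abel)
    rw [h2] at h1
    simp at h1
  obtain ⟨φ₁, hφ₁, hker⟩ := Submodule.exists_le_ker_of_notMem hvw
  obtain ⟨φ, hφv, hφw⟩ : ∃ φ : V →ₗ[F] F, φ v = 1 ∧ φ (f v - c • v) = 0 := by
    refine ⟨(φ₁ v)⁻¹ • φ₁, by simp [hφ₁], ?_⟩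
    have : φ₁ (f v - c • v) = 0 := hker (Submodule.mem_span_singleton_self _)
    rw [LinearMap.smul_apply, this, smul_zero]
  have hval : ∀ φ' : V →ₗ[F] F, φ' v = 1 → φ' (f v - c • v) = 0 → φ' (f v) = c := by
    intro φ' h1 h2
    rw [map_sub, map_smul, h1, smul_eq_mul, mul_one] at h2
    exact sub_eq_zero.mp h2
  by_cases hgood : n = 0 ∨ ∀ μ : F, ∃ u, φ u = 0 ∧ ∀ a : F, f u ≠ μ • u + a • v
  · exact ⟨v, φ, hφv, hval φ hφv hφw, hgood⟩
  push Not at hgood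
  obtain ⟨hn, μ, hμ⟩ := hgood
  -- The compression along `φ` is scalar here and the dimension is at least 3, so some `l ≠ 0` kills
  -- `v` and `f v - c • v`. Then `φ - l` has the same required values, and its compression turns out
  -- to be nonscalar.
  have hlt : Submodule.span F (Set.range ![v, f v - c • v]) < ⊤ := by
    refine lt_top_iff_ne_top.mpr fun htop => ?_
    have h1 := finrank_range_le_card (R := F) ![v, f v - c • v]
    rw [Set.finrank, htop, finrank_top, hV, Fintype.card_fin] at h1
    omega
  obtain ⟨l, hl0, hl⟩ := Submodule.exists_le_ker_of_lt_top _ hlt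
  have hlv : l v = 0 := hl (Submodule.subset_span ⟨0, rfl⟩)
  have hlw : l (f v - c • v) = 0 := hl (Submodule.subset_span ⟨1, rfl⟩)
  have h1 : (φ - l) v = 1 := by simp [hφv, hlv]
  have h2 : (φ - l) (f v - c • v) = 0 := by rw [LinearMap.sub_apply, hφw, hlw, sub_zero]
  refine ⟨v, φ - l, h1, hval _ h1 h2, Or.inr fun μ' => ?_⟩
  by_contra! hμ'
  obtain ⟨y, hy⟩ : ∃ y, l y ≠ 0 := by
    by_contra! h
    exact hl0 (LinearMap.ext h)
  set w := f v - c • v with hw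
  have hfv : f v = c • v + w := by rw [hw]; abel
  have hvw' : ∀ s t : F, s • v + t • w = 0 → s = 0 ∧ t = 0 := by
    intro s t hst
    obtain ⟨h3, h4⟩ := hv (s - t * c) t (by
      rw [← hst, hw, sub_smul, mul_smul, smul_sub]
      abel)
    rw [h4] at h3
    exact ⟨by simpa using h3, h4⟩
  -- If both compressions were scalar, the vector `w`, common to both kernels, would force the same
  -- scalar.
  obtain ⟨a, ha⟩ := hμ w hφw
  obtain ⟨a', ha'⟩ := hμ' w h2
  have hμμ : μ = μ' := by
    obtain ⟨-, h4⟩ := hvw' (a - a') (μ - μ') (by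
      rw [sub_smul, sub_smul]
      have := ha.symm.trans ha'
      rw [← sub_eq_zero] at this
      rw [← this]
      abel)
    exact sub_eq_zero.mp h4
  subst hμμ
  set u := y - (φ - l) y • v with hu
  have hu' : (φ - l) u = 0 := by
    rw [hu, map_sub, map_smul, h1, smul_eq_mul, mul_one, sub_self]
  have hlu : l u = l y := by
    rw [hu, map_sub, map_smul, hlv, smul_zero, sub_zero]
  have hφu : φ u = l y := by
    rw [LinearMap.sub_apply, hlu] at hu'
    exact sub_eq_zero.mp hu'
  -- Comparing `f` on `u ∈ ker (φ - l)` and on `u - l y • v ∈ ker φ` puts `l y • w` in the line of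
  -- `v`, which is impossible.
  obtain ⟨b, hb⟩ := hμ' u hu'
  obtain ⟨b', hb'⟩ := hμ (u - l y • v) (by
    rw [map_sub, map_smul, hφu, hφv, smul_eq_mul, mul_one, sub_self])
  rw [map_sub, map_smul, hb, hfv] at hb'
  obtain ⟨-, h4⟩ := hvw' (b - l y * c + μ * l y - b') (-l y) (by
    rw [← sub_eq_zero] at hb'
    rw [← hb']
    module)
  exact hy (neg_eq_zero.mp h4)

/-- A nonscalar endomorphism has a matrix in which all but the last diagonal entry are
prescribed; the basis is given together with its dual basis. -/
theorem LinearMap.exists_dual_families_of_not_scalar {F : Type*} [Field F] (n : ℕ) :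
    ∀ {V : Type*} [AddCommGroup V] [Module F V] [FiniteDimensional F V],
      finrank F V = n + 1 → ∀ f : V →ₗ[F] V, (n = 0 ∨ ∀ μ : F, f ≠ μ • 1) → ∀ c : Fin n → F,
        ∃ (e : Fin (n + 1) → V) (e' : Fin (n + 1) → V →ₗ[F] F),
          (∀ i j, e' i (e j) = if i = j then 1 else 0) ∧
          ∀ i : Fin n, e' i.castSucc (f (e i.castSucc)) = c i := by
  induction n with
  | zero =>
    intro V _ _ _ hV f _ c
    have : Nontrivial V := nontrivial_of_finrank_pos (R := F) (by omega)
    obtain ⟨v, hv⟩ := exists_ne (0 : V)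
    obtain ⟨φ, hφ, -⟩ := Submodule.exists_le_ker_of_notMem (K := F) (p := ⊥) (v := v) (by simpa)
    refine ⟨fun _ => v, fun _ => (φ v)⁻¹ • φ, fun i j => ?_, fun i => i.elim0⟩
    rw [if_pos (Subsingleton.elim (α := Fin 1) i j), LinearMap.smul_apply, smul_eq_mul, inv_mul_cancel₀ hφ]
  | succ n ih =>
    intro V _ _ _ hV f hf c
    have hf' := hf.resolve_left (by omega)
    obtain ⟨v, φ, hφv, hφf, hns⟩ :=
      LinearMap.exists_functional_of_not_scalar hV f hf' (c 0)
    have hP : ∀ u, (LinearMap.id - φ.smulRight v : V →ₗ[F] V) u ∈ LinearMap.ker φ := by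
      intro u
      simp [hφv]
    let P : V →ₗ[F] LinearMap.ker φ := LinearMap.codRestrict _ _ hP
    let g : LinearMap.ker φ →ₗ[F] LinearMap.ker φ := P ∘ₗ f ∘ₗ (LinearMap.ker φ).subtype
    have hPcoe : ∀ u, (P u : V) = u - φ u • v := fun u => rfl
    have hPker : ∀ u : LinearMap.ker φ, P u = u := by
      intro u
      apply Subtype.ext
      rw [hPcoe, LinearMap.mem_ker.mp u.2, zero_smul, sub_zero]
    have hPv : P v = 0 := by
      apply Subtype.ext
      rw [hPcoe, hφv, one_smul, sub_self]
      rfl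
    have hW : finrank F (LinearMap.ker φ) = n + 1 := by
      have h1 := LinearMap.finrank_range_add_finrank_ker φ
      have h2 : LinearMap.range φ = ⊤ := by
        rw [LinearMap.range_eq_top]
        intro x
        exact ⟨x • v, by simp [hφv]⟩
      rw [h2, finrank_top, finrank_self, hV] at h1
      omega
    obtain ⟨e, e', hee, hc⟩ := ih hW g (hns.imp_right fun h μ hg => by
      obtain ⟨u, hu, hne⟩ := h μ
      refine hne (φ (f u)) ?_
      have h3 := congrArg Subtype.val (LinearMap.congr_fun hg ⟨u, hu⟩)
      have h4 : f u - φ (f u) • v = μ • u := h3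
      rw [← h4]
      abel) (fun i => c i.succ)
    -- Composing with the projection `P` along `v` makes the old functionals vanish at `v`, and on
    -- `f (e i)` they see the compression `g`.
    refine ⟨Fin.cons v fun i => (e i : V), Fin.cons φ fun i => e' i ∘ₗ P, ?_, ?_⟩
    · intro i j
      refine Fin.cases ?_ (fun i => ?_) i <;> refine Fin.cases ?_ (fun j => ?_) j
      · simp [hφv]
      · have : φ (e j) = 0 := (e j).2
        simp [this, (Fin.succ_ne_zero j).symm]
      · simp [hPv]
      · simp [hPker, hee]
    · intro i
      refine Fin.cases ?_ (fun i => ?_) i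
      · simpa using hφf
      · simpa [g] using hc i

/-- A nonscalar matrix is similar to a matrix with any prescribed diagonal of the same trace. -/
theorem Matrix.exists_similar_diag_eq {F : Type*} [Field F] {n : ℕ} (X : Matrix (Fin n) (Fin n) F)
    (hX : ∀ μ : F, X ≠ μ • 1) (c : Fin n → F) (hc : ∑ i, c i = X.trace) :
    ∃ P Q : Matrix (Fin n) (Fin n) F, P * Q = 1 ∧ ∀ i, (P * X * Q) i i = c i := by
  obtain _ | n := n
  · exact ⟨1, 1, mul_one 1, fun i => i.elim0⟩
  obtain ⟨e, e', hee, hdiag⟩ := LinearMap.exists_dual_families_of_not_scalar n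
    (V := Fin (n + 1) → F) (by simp) (Matrix.toLin' X) (Or.inr fun μ h => hX μ (by
      apply Matrix.toLin'.injective
      rw [h, map_smul, Matrix.toLin'_one]
      rfl)) (fun i => c i.castSucc)
  let P : Matrix (Fin (n + 1)) (Fin (n + 1)) F := .of fun i j => e' i fun l => if j = l then 1 else 0
  let Q : Matrix (Fin (n + 1)) (Fin (n + 1)) F := .of fun i j => e j i
  have hP : ∀ (i) (u : Fin (n + 1) → F), (P.mulVec u) i = e' i u := by
    intro i u
    rw [LinearMap.pi_apply_eq_sum_univ (e' i)]
    simp only [Matrix.mulVec, dotProduct, P, Matrix.of_apply, smul_eq_mul, mul_comm]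
  have hPQ : P * Q = 1 := by
    ext i j
    rw [Matrix.one_apply, ← hee i j, ← hP]
    rfl
  have hval : ∀ i j, (P * X * Q) i j = e' i (X.mulVec (e j)) := by
    intro i j
    rw [Matrix.mul_assoc, ← hP]
    rfl
  have hcs : ∀ i : Fin n, (P * X * Q) i.castSucc i.castSucc = c i.castSucc := by
    intro i
    rw [hval, ← hdiag i, Matrix.toLin'_apply]
  refine ⟨P, Q, hPQ, fun i => ?_⟩
  refine Fin.lastCases ?_ hcs i
  -- Equality of traces forces the last diagonal entry.
  have htr : (P * X * Q).trace = X.trace := by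
    rw [Matrix.trace_mul_comm, ← Matrix.mul_assoc, mul_eq_one_comm.mp hPQ, Matrix.one_mul]
  rw [← hc, Matrix.trace, Fin.sum_univ_castSucc, Fin.sum_univ_castSucc] at htr
  simp only [Matrix.diag_apply, hcs] at htr
  exact add_left_cancel htr

end PrescribedDiagonal

/-! ### Scalar and nonscalar matrices over a finite field -/

section FiniteFields

open Module

/-- Bézout for the exponent, with `x ^ (q - 1) = 1`. The last clause keeps nonvanishing when `d`-th
powers become `k`-th powers. -/
lemma FiniteField.exists_pow_eq_pow_gcd {K : Type*} [Field K] [Fintype K] {k : ℕ} (hk : k ≠ 0)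
    (x : K) : ∃ y : K, y ^ k = x ^ k.gcd (Fintype.card K - 1) ∧ (y = 0 → x = 0) := by
  rcases eq_or_ne x 0 with rfl | hx
  · exact ⟨0, by rw [zero_pow hk, zero_pow (Nat.gcd_ne_zero_left hk)], fun h => h⟩
  · refine ⟨x ^ k.gcdA (Fintype.card K - 1), ?_, fun h => absurd h (zpow_ne_zero _ hx)⟩
    rw [← zpow_natCast x, Nat.gcd_eq_gcd_ab, zpow_add₀ hx, zpow_mul x ((Fintype.card K - 1 : ℕ) : ℤ),
      zpow_natCast, FiniteField.pow_card_sub_one_eq_one x hx, one_zpow, mul_one, mul_comm, zpow_mul,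
      zpow_natCast]

/-- Waring's problem with two summands in a large finite field. -/
lemma FiniteField.exists_pow_add_pow_eq {K : Type*} [Field K] [Fintype K] {k : ℕ} (hk : k ≠ 0)
    (hK : (k.gcd (Fintype.card K - 1) - 1) ^ 4 < Fintype.card K) (t : K) :
    ∃ x y : K, x ^ k + y ^ k = t := by
  obtain ⟨x, y, h⟩ := _root_.exists_pow_add_pow_eq (Nat.gcd_dvd_right _ _) hK t
  obtain ⟨x', hx, -⟩ := FiniteField.exists_pow_eq_pow_gcd hk x
  obtain ⟨y', hy, -⟩ := FiniteField.exists_pow_eq_pow_gcd hk y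
  exact ⟨x', y', by rw [hx, hy, h]⟩

/-- A scalar matrix is a sum of two `k`-th powers if the scalar is one in some algebra of the
right dimension. -/
lemma Matrix.exists_pow_add_pow_eq_smul_one {F R : Type*} [Field F] [Ring R] [Algebra F R]
    [FiniteDimensional F R] {n k : ℕ} (hR : finrank F R = n) {t : F}
    (h : ∃ x y : R, x ^ k + y ^ k = algebraMap F R t) :
    ∃ A B : Matrix (Fin n) (Fin n) F, A ^ k + B ^ k = t • 1 := by
  obtain ⟨x, y, hxy⟩ := h
  let φ := Algebra.leftMulMatrix (finBasisOfFinrankEq F R hR)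
  refine ⟨φ x, φ y, ?_⟩
  rw [← map_pow, ← map_pow, ← map_add, hxy, AlgHom.commutes, Algebra.algebraMap_eq_smul_one]

theorem Matrix.exists_pow_add_pow_eq_smul_one_of_finite {F : Type*} [Field F] [Fintype F]
    {n k : ℕ} (hn : 2 ≤ n) (hk : k ≠ 0)
    (h2 : (k.gcd (Fintype.card F ^ 2 - 1) - 1) ^ 4 < Fintype.card F ^ 2)
    (h3 : (k.gcd (Fintype.card F ^ 3 - 1) - 1) ^ 4 < Fintype.card F ^ 3) (t : F) :
    ∃ A B : Matrix (Fin n) (Fin n) F, A ^ k + B ^ k = t • 1 := by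
  obtain ⟨p, hchar⟩ := CharP.exists F
  have : Fact p.Prime := ⟨CharP.char_is_prime F p⟩
  let K₂ := FiniteField.Extension F p 2
  let K₃ := FiniteField.Extension F p 3
  have : Fintype K₂ := Fintype.ofFinite K₂
  have : Fintype K₃ := Fintype.ofFinite K₃
  have hK₂ : Fintype.card K₂ = Fintype.card F ^ 2 := by
    rw [← Nat.card_eq_fintype_card, ← Nat.card_eq_fintype_card, FiniteField.natCard_extension]
  have hK₃ : Fintype.card K₃ = Fintype.card F ^ 3 := by
    rw [← Nat.card_eq_fintype_card, ← Nat.card_eq_fintype_card, FiniteField.natCard_extension]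
  obtain ⟨a, b, hab⟩ : ∃ a b : ℕ, n = 2 * a + 3 * b := by
    rcases Nat.even_or_odd' n with ⟨m, h | h⟩
    · exact ⟨m, 0, by omega⟩
    · exact ⟨m - 1, 1, by omega⟩
  obtain ⟨x, y, hxy⟩ := FiniteField.exists_pow_add_pow_eq hk (by rwa [hK₂]) (algebraMap F K₂ t)
  obtain ⟨z, w, hzw⟩ := FiniteField.exists_pow_add_pow_eq hk (by rwa [hK₃]) (algebraMap F K₃ t)
  refine Matrix.exists_pow_add_pow_eq_smul_one (R := (Fin a → K₂) × (Fin b → K₃)) ?_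
    ⟨(fun _ => x, fun _ => z), (fun _ => y, fun _ => w), ?_⟩
  · rw [finrank_prod, finrank_pi_fintype, finrank_pi_fintype, FiniteField.finrank_extension,
      FiniteField.finrank_extension]
    simp
    omega
  · ext i
    · exact hxy
    · exact hzw

theorem Matrix.exists_pow_add_pow_eq_of_not_scalar {F : Type*} [Field F] [Fintype F] {n k : ℕ}
    (hn : 2 ≤ n) (hk : (k : F) ≠ 0)
    (h3 : (k.gcd (Fintype.card F - 1) - 1) ^ 3 ≤ Fintype.card F)
    (h2 : 2 * k.gcd (Fintype.card F - 1) < Fintype.card F) {X : Matrix (Fin n) (Fin n) F}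
    (hX : ∀ μ : F, X ≠ μ • 1) :
    ∃ A B : Matrix (Fin n) (Fin n) F, A ^ k + B ^ k = X := by
  have hk0 : k ≠ 0 := by
    rintro rfl
    simp at hk
  obtain ⟨m, rfl⟩ : ∃ m, n = m + 2 := ⟨n - 2, by omega⟩
  -- The diagonal will be `x'^k + z'^k`, `y'^k + w'^k`, then `m` entries `1^k + 1^k`; hence the
  -- target `X.trace - 2 * m`.
  obtain ⟨x, y, z, w, hsum, hxy, hzw⟩ :=
    exists_sum_four_pow (Nat.gcd_dvd_right k _) h3 h2 (X.trace - 2 * m)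
  obtain ⟨x', hx, hx0⟩ := FiniteField.exists_pow_eq_pow_gcd hk0 x
  obtain ⟨y', hy, hy0⟩ := FiniteField.exists_pow_eq_pow_gcd hk0 y
  obtain ⟨z', hz, hz0⟩ := FiniteField.exists_pow_eq_pow_gcd hk0 z
  obtain ⟨w', hw, hw0⟩ := FiniteField.exists_pow_eq_pow_gcd hk0 w
  have huniq : ∀ r s : F, (r ≠ 0 ∨ s ≠ 0) → ∀ i j : Fin (m + 2),
      (Fin.cons r (Fin.cons s fun _ => 1) : Fin (m + 2) → F) i = 0 →
      (Fin.cons r (Fin.cons s fun _ => 1) : Fin (m + 2) → F) j = 0 → i = j := by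
    intro r s hrs i j
    refine Fin.cases ?_ (fun i => Fin.cases ?_ (fun i => ?_) i) i <;>
      refine Fin.cases ?_ (fun j => Fin.cases ?_ (fun j => ?_) j) j <;> simp <;> tauto
  let a : Fin (m + 2) → F := Fin.cons x' (Fin.cons y' fun _ => 1)
  let b : Fin (m + 2) → F := Fin.cons z' (Fin.cons w' fun _ => 1)
  have htr : ∑ i, (a i ^ k + b i ^ k) = X.trace := by
    simp only [a, b, Fin.sum_univ_succ, Fin.cons_zero, Fin.cons_succ, one_pow, hx, hy, hz, hw,
      Finset.sum_const, Finset.card_univ, Fintype.card_fin, nsmul_eq_mul]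
    linear_combination hsum
  obtain ⟨P, Q, hPQ, hdiag⟩ := Matrix.exists_similar_diag_eq X hX _ htr
  obtain ⟨A, B, hAB⟩ := Matrix.exists_pow_add_pow_eq_of_diag hk (P * X * Q) a b hdiag
    (huniq _ _ (hxy.imp (mt hx0) (mt hy0))) (huniq _ _ (hzw.imp (mt hz0) (mt hw0)))
  have hQP := mul_eq_one_comm.mp hPQ
  let u : (Matrix (Fin (m + 2)) (Fin (m + 2)) F)ˣ := ⟨Q, P, hQP, hPQ⟩
  refine ⟨Q * A * P, Q * B * P, ?_⟩
  have hconj : ∀ M : Matrix (Fin (m + 2)) (Fin (m + 2)) F, (Q * M * P) ^ k = Q * M ^ k * P :=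
    fun M => Units.conj_pow u M k
  rw [hconj, hconj, ← Matrix.add_mul, ← Matrix.mul_add, hAB]
  calc Q * (P * X * Q) * P = (Q * P) * X * (Q * P) := by simp only [Matrix.mul_assoc]
    _ = X := by rw [hQP, Matrix.one_mul, Matrix.mul_one]

end FiniteFields

/-! ### Numerical consequences of the bound on `q` -/

section Bounds

lemma pow_four_lt_sq_of_sq_add_one_le {d q : ℕ} (hd : 1 ≤ d)
    (h : ((d : ℝ) - 1) ^ 2 + 1 ≤ q) : (d - 1) ^ 4 < q ^ 2 := by
  obtain ⟨e, rfl⟩ : ∃ e, d = e + 1 := ⟨d - 1, by omega⟩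
  rw [Nat.cast_add_one, add_sub_cancel_right] at h
  have h' : e ^ 2 + 1 ≤ q := by exact_mod_cast h
  rw [Nat.add_sub_cancel]
  calc e ^ 4 = (e ^ 2) ^ 2 := by ring
    _ < q ^ 2 := Nat.pow_lt_pow_left (by omega) two_ne_zero

lemma pow_four_lt_cube_of_floor_rpow_add_one_le {d q : ℕ} (hd : 1 ≤ d)
    (h : (⌊((d : ℝ) - 1) ^ ((4 : ℝ) / 3)⌋ : ℝ) + 1 ≤ q) : (d - 1) ^ 4 < q ^ 3 := by
  obtain ⟨e, rfl⟩ : ∃ e, d = e + 1 := ⟨d - 1, by omega⟩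
  rw [Nat.cast_add_one, add_sub_cancel_right] at h
  have h1 : (e : ℝ) ^ ((4 : ℝ) / 3) < q := (Int.lt_floor_add_one _).trans_le h
  have h2 : ((e : ℝ) ^ ((4 : ℝ) / 3)) ^ 3 < (q : ℝ) ^ 3 :=
    pow_lt_pow_left₀ h1 (by positivity) three_ne_zero
  rw [← Real.rpow_natCast, ← Real.rpow_mul (by positivity)] at h2
  norm_num at h2
  rw [Nat.add_sub_cancel]
  exact_mod_cast h2

lemma cube_le_and_two_mul_lt_of_sqrt_le {d q : ℕ} (hd : 1 ≤ d) (hdq : d ∣ q - 1) (hq : 2 ≤ q)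
    (h : √(((d : ℝ) - 1) ^ 6 + 6 * (d : ℝ)) ≤ q) : (d - 1) ^ 3 ≤ q ∧ 2 * d < q := by
  obtain ⟨e, rfl⟩ : ∃ e, d = e + 1 := ⟨d - 1, by omega⟩
  rw [Real.sqrt_le_left (by positivity), Nat.cast_add_one, add_sub_cancel_right] at h
  have h' : e ^ 6 + 6 * (e + 1) ≤ q ^ 2 := by exact_mod_cast h
  rw [Nat.add_sub_cancel]
  constructor
  · refine le_of_not_gt fun hlt => ?_
    have := Nat.pow_lt_pow_left hlt two_ne_zero
    rw [← pow_mul, show 3 * 2 = 6 from rfl] at this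
    omega
  · obtain ⟨m, hm⟩ := hdq
    -- With `q - 1 = m d`, `m = 0` contradicts `2 ≤ q`, and `m = 1` gives `q = e + 2`, too small as
    -- `e^6 + 6e + 6 > (e + 2)^2`. This is what the term `6d` excludes.
    obtain rfl | rfl | hm2 : m = 0 ∨ m = 1 ∨ 2 ≤ m := by omega
    · omega
    · exfalso
      obtain rfl : q = e + 2 := by omega
      have : e ^ 2 ≤ e ^ 6 := by
        rcases Nat.eq_zero_or_pos e with rfl | he
        · simp
        · exact Nat.pow_le_pow_right he (by omega)
      nlinarith
    · have := Nat.mul_le_mul_left (e + 1) hm2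
      omega

end Bounds

theorem theorem1p8 {F : Type*} [Field F] [Fintype F] (p l q k n : ℕ)
    (hp : p.Prime) (hq : q = p ^ l) (hF : Fintype.card F = q)
    (hn : 2 ≤ n) (hpk : ¬ p ∣ k)
    (hbound :
      max (Real.sqrt (((dGcd k q 1 : ℝ) - 1) ^ 6 + 6 * (dGcd k q 1 : ℝ)))
        (max (((dGcd k q 2 : ℝ) - 1) ^ 2 + 1)
          ((⌊((dGcd k q 3 : ℝ) - 1) ^ ((4 : ℝ) / 3)⌋ : ℝ) + 1)) ≤ (q : ℝ)) :
    sumTwoPowers k n F = Set.univ := by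
  have hk0 : k ≠ 0 := by
    rintro rfl
    exact hpk (dvd_zero p)
  have hdpos : ∀ m, 1 ≤ dGcd k q m := fun m => Nat.gcd_pos_of_pos_left _ (Nat.pos_of_ne_zero hk0)
  have hq2 : 2 ≤ q := hF ▸ Fintype.one_lt_card
  have : Fact p.Prime := ⟨hp⟩
  have : CharP F p := charP_of_card_eq_prime_pow (f := l) (by rw [hF, hq])
  have hk : (k : F) ≠ 0 := by rwa [Ne, CharP.cast_eq_zero_iff F p]
  rw [max_le_iff, max_le_iff] at hbound
  obtain ⟨hb1, hb2, hb3⟩ := hbound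
  obtain ⟨hc1, hc1'⟩ := cube_le_and_two_mul_lt_of_sqrt_le (hdpos 1)
    (by rw [dGcd, pow_one]; exact Nat.gcd_dvd_right _ _) hq2 hb1
  have hc2 := pow_four_lt_sq_of_sq_add_one_le (hdpos 2) hb2
  have hc3 := pow_four_lt_cube_of_floor_rpow_add_one_le (hdpos 3) hb3
  rw [dGcd, pow_one] at hc1 hc1'
  rw [dGcd] at hc2 hc3
  subst hF
  refine Set.eq_univ_of_forall fun X => ?_
  obtain ⟨A, B, h⟩ : ∃ A B : Matrix (Fin n) (Fin n) F, A ^ k + B ^ k = X := by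
    by_cases hX : ∀ μ : F, X ≠ μ • 1
    · exact Matrix.exists_pow_add_pow_eq_of_not_scalar hn hk hc1 hc1' hX
    · push Not at hX
      obtain ⟨μ, rfl⟩ := hX
      exact Matrix.exists_pow_add_pow_eq_smul_one_of_finite hn hk0 hc2 hc3 μ
  exact ⟨A, B, h.symm⟩
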